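/- Let $X$ be a random vector in $\mathbb{R}^d$, $d \ge 1$. Let $K_X(u) := \log \mathbb{E}\, e^{u\cdot X} \in (-\infty,+\infty]$ for $u\in\mathbb{R}^d$, and let $I_X(v) := \sup_{u\in\mathbb{R}^d}(u\cdot v - K_X(u)) \in [0,+\infty]$ for $v\in\mathbb{R}^d$. For a function $f:\mathbb{R}^d\to(-\infty,+\infty]$ put $\mathcal{D}(f) := \{x : f(x)<+\infty\}$. Let $C_X$ be the convex hull of the topological support of $X$ (the smallest closed set $S$ with $\mathbb{P}(X\in S)=1$). Write $\operatorname{int}$, $\operatorname{cl}$ and $\partial$ for the interior, the closure and the boundary in $\mathbb{R}^d$, and $\operatorname{rint} A$ for the interior of $A$ relative to its affine hull. A hyperplane $L$ supports a convex set $C$ if $L\cap C\neq\varnothing$ and $C$ is contained in one of the two closed half-spaces bounded by $L$ ($C\subset L$ is allowed). The function $I_X$ is strictly convex on a set $A\subset\mathcal{D}(I_X)$ if it is affine on no (nondegenerate) line segment contained in $A$. When $\operatorname{int}\mathcal{D}(K_X)\ne\varnothing$, the function $K_X$, which is differentiable on $\operatorname{int}\mathcal{D}(K_X)$, is called steep if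 $|\nabla K_X(u_n)|\to\infty$ for every sequence $(u_n)$ in $\operatorname{int}\mathcal{D}(K_X)$ that converges to a point of $\partial\mathcal{D}(K_X)$. (a) We have $\operatorname{rint} C_X\subset\mathcal{D}(I_X)\subset\operatorname{cl} C_X$ and $\operatorname{rint}\mathcal{D}(I_X)=\operatorname{rint} C_X$. Moreover, $I_X=+\infty$ at every point of every hyperplane $L$ in $\mathbb{R}^d$ that supports $\operatorname{cl} C_X$ and satisfies $\mathbb{P}(X\in L)=0$. (b) $I_X$ is strictly convex on $\operatorname{rint}\mathcal{D}(I_X)$ if and only if $\operatorname{int}\mathcal{D}(K_X)\neq\varnothing$ and $K_X$ is steep. -/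

import Mathlib

open MeasureTheory Filter Topology

noncomputable section

namespace RateFunction

variable {Ω : Type*} [MeasurableSpace Ω] {d : ℕ}

/-- The logarithmic Laplace transform `K_X(u) = log E exp (u · X)`, with values in `(-∞, +∞]`:
the expectation is the Lebesgue integral of a nonnegative function, and `log (+∞) = +∞`. -/
def logLaplace (P : Measure Ω) (X : Ω → EuclideanSpace ℝ (Fin d))
    (u : EuclideanSpace ℝ (Fin d)) : EReal :=
  ENNReal.log (∫⁻ ω, ENNReal.ofReal (Real.exp (inner ℝ u (X ω))) ∂P)

/-- The rate function `I_X(v) = sup_u (u · v - K_X(u))`; the terms with `K_X(u) = +∞` are `-∞`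
and do not contribute to the supremum. -/
def rate (P : Measure Ω) (X : Ω → EuclideanSpace ℝ (Fin d))
    (v : EuclideanSpace ℝ (Fin d)) : EReal :=
  ⨆ u : EuclideanSpace ℝ (Fin d), ((inner ℝ u v : ℝ) : EReal) - logLaplace P X u

/-- The effective domain of an extended-real-valued function. -/
def effDomain (f : EuclideanSpace ℝ (Fin d) → EReal) : Set (EuclideanSpace ℝ (Fin d)) :=
  {v | f v < ⊤}

/-- The convex support `C_X`: the convex hull of the topological support of the law of `X`. -/
def convexSupport (P : Measure Ω) (X : Ω → EuclideanSpace ℝ (Fin d)) :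
    Set (EuclideanSpace ℝ (Fin d)) :=
  convexHull ℝ (P.map X).support

/-- `L` is a hyperplane that supports `C`: it intersects `C`, and `C` lies in one of the two closed
half-spaces bounded by `L` (`C ⊆ L` is allowed). -/
def IsSupportingHyperplane (L C : Set (EuclideanSpace ℝ (Fin d))) : Prop :=
  ∃ (a : EuclideanSpace ℝ (Fin d)) (b : ℝ), a ≠ 0 ∧ L = {x | inner ℝ a x = b} ∧
    (L ∩ C).Nonempty ∧ (C ⊆ {x | inner ℝ a x ≤ b} ∨ C ⊆ {x | b ≤ inner ℝ a x})

/-- `f` is affine (in particular finite) on the closed line segment with endpoints `x`, `y`. -/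
def IsAffineOnSegment (f : EuclideanSpace ℝ (Fin d) → EReal)
    (x y : EuclideanSpace ℝ (Fin d)) : Prop :=
  ∃ g : EuclideanSpace ℝ (Fin d) →ᵃ[ℝ] ℝ, ∀ z ∈ segment ℝ x y, f z = ((g z : ℝ) : EReal)

/-- Strict convexity of a convex function `f` on a subset `A` of its effective domain:
`f` is affine on no (nondegenerate) line segment contained in `A`. -/
def IsStrictlyConvexOn (f : EuclideanSpace ℝ (Fin d) → EReal)
    (A : Set (EuclideanSpace ℝ (Fin d))) : Prop :=
  ∀ x y : EuclideanSpace ℝ (Fin d), x ≠ y → segment ℝ x y ⊆ A → ¬ IsAffineOnSegment f x y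

/-- Steepness at the boundary of the effective domain: the norm of the gradient tends to infinity
along every sequence in the interior of the domain that converges to a boundary point. The gradient
is only taken at interior points of the domain, near which `f` is finite. -/
def IsSteep (f : EuclideanSpace ℝ (Fin d) → EReal) : Prop :=
  ∀ (u : ℕ → EuclideanSpace ℝ (Fin d)) (p : EuclideanSpace ℝ (Fin d)),
    (∀ n, u n ∈ interior (effDomain f)) → p ∈ frontier (effDomain f) →
    Tendsto u atTop (𝓝 p) →
    Tendsto (fun n => ‖gradient (fun w => (f w).toReal) (u n)‖) atTop atTop

end RateFunction

end

open MeasureTheory Filter Topology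

set_option linter.unusedSectionVars false

noncomputable section

/-! Everything is read off the recentred transform `laplace μ v u` = E exp(u · (X - v)) = exp(K(u) -
u · v), since I(v) = -log inf_u `laplace μ v u`. Thus I(v) is finite exactly when this infimum is
positive, which is `rateDomain`.

(a) Averages of X over small balls of positive mass lie in `rateDomain`, because 1 + t ≤ e^t
(`setAverage_mem_rateDomain`); so the support lies in its closure. Conversely, if X lies a.s. in an
open half-space with v on or beyond its boundary, then `laplace μ v` tends to 0 along the normal
(`notMem_rateDomain_of_ae_neg`); this excludes points outside cl C_X and points of null supporting
hyperplanes. So D(I) and C_X are convex sets with the same closure, hence the same relative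
interior.

(b) A minimizer u of `laplace μ v` with K(u) finite is a point with v ∈ ∂K(u). The values of ∂K fill
exactly rint D(I) (`exists_isSubgradientAt`, `IsSubgradientAt.mem_intrinsicInterior`), and I is
affine on each convex set ∂K(u). So strict convexity forces each ∂K(u) to have at most one point. At
interior points of D(K) this holds by differentiability; at any other point of D(K), a normal vector
to D(K) can be added to a subgradient. Uniqueness therefore means that ∂K is empty off int D(K).
Given a nonempty interior, this is steepness: bounded gradients would accumulate at a subgradient at
the boundary, and a boundary subgradient keeps the gradients bounded along a segment into the
interior. -/

namespace RateFunction

/-! ### Relative interiors and supporting hyperplanes -/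

section ConvexGeometry

variable {E : Type*} [NormedAddCommGroup E] [InnerProductSpace ℝ E]

/-- The relative interior, read in the direction space of the affine hull. -/
theorem mem_intrinsicInterior_iff_of_direction {s : Set E} {z : E} (hz : z ∈ s)
    {W : Submodule ℝ E} (hW : (affineSpan ℝ s).direction = W) {x : E} :
    x ∈ intrinsicInterior ℝ s ↔
      ∃ w ∈ interior ((fun w : W => z + (w : E)) ⁻¹' s), z + (w : E) = x := by
  subst hW
  have hzs : z ∈ affineSpan ℝ s := subset_affineSpan ℝ s hz
  have : Nonempty (affineSpan ℝ s) := ⟨⟨z, hzs⟩⟩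
  let e := (AffineIsometryEquiv.vaddConst ℝ (⟨z, hzs⟩ : affineSpan ℝ s)).toHomeomorph
  have he : ∀ w, ((e w : affineSpan ℝ s) : E) = z + (w : E) := fun w => by
    change (w : E) + z = _
    rw [add_comm]
  have hpre : ((fun w : (affineSpan ℝ s).direction => z + (w : E)) ⁻¹' s)
      = e ⁻¹' ((↑) ⁻¹' s) := by
    ext w
    simp [he]
  rw [hpre, ← e.preimage_interior, mem_intrinsicInterior]
  constructor
  · rintro ⟨y, hy, rfl⟩
    exact ⟨e.symm y, by simpa using hy, by rw [← he]; simp⟩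
  · rintro ⟨w, hw, rfl⟩
    exact ⟨e w, hw, he w⟩

theorem convex_preimage_add_submodule {s : Set E} (hs : Convex ℝ s) (z : E)
    (W : Submodule ℝ E) : Convex ℝ ((fun w : W => z + (w : E)) ⁻¹' s) :=
  (hs.translate_preimage_right z).linear_preimage W.subtype

theorem sub_mem_direction_affineSpan {s : Set E} {z x : E} (hz : z ∈ s)
    (hx : x ∈ affineSpan ℝ s) : x - z ∈ (affineSpan ℝ s).direction :=
  AffineSubspace.vsub_mem_direction hx (subset_affineSpan ℝ s hz)

theorem exists_pos_add_smul_mem_of_mem_intrinsicInterior {s : Set E} {z y : E}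
    (hz : z ∈ intrinsicInterior ℝ s) (hy : y ∈ (affineSpan ℝ s).direction) :
    ∃ r : ℝ, 0 < r ∧ z + r • y ∈ s := by
  have hzs := intrinsicInterior_subset hz
  obtain ⟨w, hw, hwz⟩ := (mem_intrinsicInterior_iff_of_direction hzs rfl).1 hz
  have hw0 : w = 0 := by
    ext
    simpa using hwz
  subst hw0
  have hcont : Tendsto (fun r : ℝ => r • (⟨y, hy⟩ : (affineSpan ℝ s).direction))
      (𝓝[>] 0) (𝓝 0) := by
    have h : Continuous (fun r : ℝ => r • (⟨y, hy⟩ : (affineSpan ℝ s).direction)) := by fun_prop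
    have := h.tendsto 0
    rw [zero_smul] at this
    exact this.mono_left nhdsWithin_le_nhds
  have hev := (hcont.eventually (mem_interior_iff_mem_nhds.1 hw)).and self_mem_nhdsWithin
  obtain ⟨r, hr, hr0⟩ := hev.exists
  exact ⟨r, hr0, hr⟩

theorem preimage_closure_add_direction {s : Set E} {z : E} (hz : z ∈ s) :
    ((fun w : (affineSpan ℝ s).direction => z + (w : E)) ⁻¹' closure s)
      = closure ((fun w : (affineSpan ℝ s).direction => z + (w : E)) ⁻¹' s) := by
  have hind : IsInducing (fun w : (affineSpan ℝ s).direction => z + (w : E)) :=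
    ((Homeomorph.addLeft z).isInducing).comp IsInducing.subtypeVal
  rw [hind.closure_eq_preimage_closure_image, Set.image_preimage_eq_of_subset]
  intro x hx
  exact ⟨⟨x - z, sub_mem_direction_affineSpan hz (subset_affineSpan ℝ s hx)⟩, by simp⟩

variable [FiniteDimensional ℝ E]

theorem affineSpan_closure_eq (s : Set E) : affineSpan ℝ (closure s) = affineSpan ℝ s := by
  refine le_antisymm (affineSpan_le.2 ?_) (affineSpan_mono ℝ subset_closure)
  exact closure_minimal (subset_affineSpan ℝ s) (AffineSubspace.closed_of_finiteDimensional _)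

theorem interior_preimage_direction_nonempty {s : Set E} (hs : Convex ℝ s) {z : E} (hz : z ∈ s) :
    (interior ((fun w : (affineSpan ℝ s).direction => z + (w : E)) ⁻¹' s)).Nonempty := by
  obtain ⟨x, hx⟩ := Set.Nonempty.intrinsicInterior hs ⟨z, hz⟩
  obtain ⟨w, hw, -⟩ := (mem_intrinsicInterior_iff_of_direction hz rfl).1 hx
  exact ⟨w, hw⟩

/-- In the direction space of the affine hull the set has nonempty interior, so the full-dimensional
fact applies. -/
theorem intrinsicInterior_closure_eq_of_convex {s : Set E} (hs : Convex ℝ s) :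
    intrinsicInterior ℝ (closure s) = intrinsicInterior ℝ s := by
  rcases s.eq_empty_or_nonempty with rfl | ⟨z, hz⟩
  · simp
  ext x
  rw [mem_intrinsicInterior_iff_of_direction (subset_closure hz)
      (congrArg AffineSubspace.direction (affineSpan_closure_eq s)),
    mem_intrinsicInterior_iff_of_direction hz rfl, preimage_closure_add_direction hz,
    (convex_preimage_add_submodule hs z _).interior_closure_eq_interior_of_nonempty_interior
      (interior_preimage_direction_nonempty hs hz)]

/-- Separating inside the direction space, rather than in `E`, rules out a normal that is constant
on `s`. -/
theorem exists_nontrivial_supporting_of_notMem_intrinsicInterior {s : Set E} (hs : Convex ℝ s)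
    {v : E} (hv : v ∈ closure s) (hvs : v ∉ intrinsicInterior ℝ s) :
    ∃ a : E, (∀ x ∈ s, inner ℝ a x ≤ inner ℝ a v) ∧ ∃ x ∈ s, inner ℝ a x < inner ℝ a v := by
  obtain ⟨z, hz⟩ : s.Nonempty := closure_nonempty_iff.1 ⟨v, hv⟩
  set B := (fun w : (affineSpan ℝ s).direction => z + (w : E)) ⁻¹' s with hB
  have hBc : Convex ℝ B := convex_preimage_add_submodule hs z _
  have hBne : (interior B).Nonempty := interior_preimage_direction_nonempty hs hz
  have hvspan : v ∈ affineSpan ℝ s := by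
    rw [← affineSpan_closure_eq]
    exact subset_affineSpan ℝ _ hv
  set w : (affineSpan ℝ s).direction := ⟨v - z, sub_mem_direction_affineSpan hz hvspan⟩ with hw
  have hwB : w ∉ interior B := fun h =>
    hvs ((mem_intrinsicInterior_iff_of_direction hz rfl).2 ⟨w, h, by simp [hw]⟩)
  obtain ⟨f, hf⟩ := geometric_hahn_banach_open_point hBc.interior isOpen_interior hwB
  set a := (InnerProductSpace.toDual ℝ (affineSpan ℝ s).direction).symm f with ha
  have hfa : ∀ y : (affineSpan ℝ s).direction, f y = inner ℝ (a : E) (y : E) := fun y => by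
    rw [← Submodule.coe_inner, ha, InnerProductSpace.toDual_symm_apply]
  have hle : ∀ y ∈ B, f y ≤ f w := by
    intro y hy
    have : y ∈ closure (interior B) := by
      rw [hBc.closure_interior_eq_closure_of_nonempty_interior hBne]
      exact subset_closure hy
    exact closure_minimal (fun b hb => (hf b hb).le)
      (isClosed_le f.continuous continuous_const) this
  refine ⟨a, fun x hx => ?_, ?_⟩
  · have := hle ⟨x - z, sub_mem_direction_affineSpan hz (subset_affineSpan ℝ s hx)⟩
      (by simpa [hB] using hx)
    rw [hfa, hfa] at this
    simpa [hw, inner_sub_right] using this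
  · obtain ⟨y, hy⟩ := hBne
    refine ⟨z + y, interior_subset (s := B) hy, ?_⟩
    have := hf y hy
    rw [hfa, hfa] at this
    simp only [hw, inner_sub_right] at this
    rw [inner_add_right]
    linarith

theorem exists_ne_zero_inner_le_of_notMem_interior {s : Set E} (hs : Convex ℝ s) {p : E}
    (hps : p ∈ s) (hp : p ∉ interior s) :
    ∃ a : E, a ≠ 0 ∧ ∀ q ∈ s, inner ℝ a q ≤ inner ℝ a p := by
  by_cases hne : (interior s).Nonempty
  · have hspan : IsOpen (affineSpan ℝ s : Set E) := by
      rw [hs.interior_nonempty_iff_affineSpan_eq_top.1 hne]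
      exact isOpen_univ
    have hv : p ∉ intrinsicInterior ℝ s := fun h => hp <|
      interior_maximal intrinsicInterior_subset
        (hspan.isOpenMap_subtype_val _ isOpen_interior) h
    obtain ⟨a, ha, x, hx, hlt⟩ :=
      exists_nontrivial_supporting_of_notMem_intrinsicInterior hs (subset_closure hps) hv
    refine ⟨a, ?_, ha⟩
    rintro rfl
    simp at hlt
  -- With empty interior the affine hull is proper, and any nonzero vector orthogonal to it works,
  -- with equality.
  · rw [hs.interior_nonempty_iff_affineSpan_eq_top] at hne
    have hdir : (affineSpan ℝ s).direction ≠ ⊤ := fun h => hne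
      ((AffineSubspace.direction_eq_top_iff_of_nonempty ⟨p, subset_affineSpan ℝ s hps⟩).1 h)
    obtain ⟨a, ha, ha0⟩ := (Submodule.ne_bot_iff _).1
      (mt Submodule.orthogonal_eq_bot_iff.1 hdir)
    refine ⟨a, ha0, fun q hq => ?_⟩
    have := (Submodule.mem_orthogonal' _ _).1 ha _
      (sub_mem_direction_affineSpan hps (subset_affineSpan ℝ s hq))
    rw [inner_sub_right] at this
    linarith

end ConvexGeometry

/-! ### The effective domain of the rate function -/

section Laplace

variable {E : Type*} [NormedAddCommGroup E] [InnerProductSpace ℝ E] [MeasurableSpace E]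

/-- The Laplace transform of the law `μ` recentred at `v`. -/
def laplace (μ : Measure E) (v u : E) : ENNReal :=
  ∫⁻ x, ENNReal.ofReal (Real.exp (inner ℝ u (x - v))) ∂μ

/-- The points at which the recentred Laplace transform is bounded away from zero; this is the
effective domain of the rate function. -/
def rateDomain (μ : Measure E) : Set E :=
  {v | ∃ c : ENNReal, c ≠ 0 ∧ ∀ u, c ≤ laplace μ v u}

theorem laplace_zero (μ : Measure E) [IsProbabilityMeasure μ] (v : E) : laplace μ v 0 = 1 := by
  simp [laplace]

/-- A linear form at a convex combination is at most its larger endpoint value, so the transform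
there is at least the one at that endpoint, and the smaller of the two bounds serves. -/
theorem convex_rateDomain (μ : Measure E) : Convex ℝ (rateDomain μ) := by
  rintro x ⟨c, hc, hcx⟩ y ⟨c', hc', hcy⟩ s t hs ht hst
  refine ⟨min c c', (lt_min hc.bot_lt hc'.bot_lt).ne', fun u => ?_⟩
  have key : inner ℝ u (s • x + t • y) ≤ max (inner ℝ u x) (inner ℝ u y) := by
    rw [inner_add_right, inner_smul_right, inner_smul_right]
    have h1 := mul_le_mul_of_nonneg_left (le_max_left (inner ℝ u x) (inner ℝ u y)) hs
    have h2 := mul_le_mul_of_nonneg_left (le_max_right (inner ℝ u x) (inner ℝ u y)) ht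
    calc _ ≤ s * max (inner ℝ u x) (inner ℝ u y) + t * max (inner ℝ u x) (inner ℝ u y) :=
          add_le_add h1 h2
      _ = _ := by rw [← add_mul, hst, one_mul]
  have mono : ∀ z, inner ℝ u (s • x + t • y) ≤ inner ℝ u z →
      laplace μ z u ≤ laplace μ (s • x + t • y) u := by
    intro z hz
    refine lintegral_mono fun w => ENNReal.ofReal_le_ofReal (Real.exp_le_exp.2 ?_)
    rw [inner_sub_right, inner_sub_right]
    linarith
  rcases le_max_iff.1 key with h | h
  · exact (min_le_left _ _).trans ((hcx u).trans (mono x h))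
  · exact (min_le_right _ _).trans ((hcy u).trans (mono y h))

theorem ofReal_integral_le_lintegral_ofReal {α : Type*} [MeasurableSpace α] {ν : Measure α}
    {f : α → ℝ} (hf : Integrable f ν) :
    ENNReal.ofReal (∫ x, f x ∂ν) ≤ ∫⁻ x, ENNReal.ofReal (f x) ∂ν := by
  rw [integral_eq_lintegral_pos_part_sub_lintegral_neg_part hf]
  exact (ENNReal.ofReal_le_ofReal (sub_le_self _ ENNReal.toReal_nonneg)).trans
    ENNReal.ofReal_toReal_le

variable [FiniteDimensional ℝ E]

theorem ae_mem_convexHull_support (μ : Measure E) : ∀ᵐ x ∂μ, x ∈ convexHull ℝ μ.support := by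
  filter_upwards [Measure.support_mem_ae (μ := μ)] with x hx using subset_convexHull ℝ _ hx

variable [BorelSpace E]

theorem measurable_ofReal_exp_inner (u v : E) :
    Measurable fun x : E => ENNReal.ofReal (Real.exp (inner ℝ u (x - v))) :=
  (ENNReal.continuous_ofReal.comp (by fun_prop)).measurable

theorem laplace_eq_mul (μ : Measure E) (v y u : E) :
    laplace μ y u = laplace μ v u * ENNReal.ofReal (Real.exp (inner ℝ u (v - y))) := by
  rw [laplace, laplace, ← lintegral_mul_const _ (measurable_ofReal_exp_inner u v)]
  refine lintegral_congr fun x => ?_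
  rw [← ENNReal.ofReal_mul (Real.exp_pos _).le, ← Real.exp_add, ← inner_add_right]
  congr 4
  abel

theorem laplace_ne_zero (μ : Measure E) [IsProbabilityMeasure μ] (v u : E) :
    laplace μ v u ≠ 0 := by
  intro h
  rw [laplace, lintegral_eq_zero_iff (measurable_ofReal_exp_inner u v)] at h
  obtain ⟨x, hx⟩ := h.exists
  simp [not_le.2 (Real.exp_pos _)] at hx

/-- This is Fatou's lemma along sequences. -/
theorem lowerSemicontinuous_laplace (μ : Measure E) (v : E) :
    LowerSemicontinuous (laplace μ v) := by
  rw [lowerSemicontinuous_iff_isClosed_preimage]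
  intro c
  refine IsSeqClosed.isClosed fun u p hu hp => ?_
  have hlim : ∀ x, ENNReal.ofReal (Real.exp (inner ℝ p (x - v)))
      = liminf (fun n => ENNReal.ofReal (Real.exp (inner ℝ (u n) (x - v)))) atTop := by
    intro x
    have hc : Continuous fun w : E => ENNReal.ofReal (Real.exp (inner ℝ w (x - v))) :=
      ENNReal.continuous_ofReal.comp (by fun_prop)
    exact ((hc.tendsto p).comp hp).liminf_eq.symm
  calc laplace μ v p
      = ∫⁻ x, liminf (fun n => ENNReal.ofReal (Real.exp (inner ℝ (u n) (x - v)))) atTop ∂μ :=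
        lintegral_congr hlim
    _ ≤ liminf (fun n => laplace μ v (u n)) atTop :=
        lintegral_liminf_le fun n => measurable_ofReal_exp_inner (u n) v
    _ ≤ c := liminf_le_of_frequently_le' (Frequently.of_forall hu)

variable (μ : Measure E) [IsProbabilityMeasure μ]

/-- By 1 + t ≤ e^t on `B`, where the linear term integrates to zero around the mean, `μ B` is a
lower bound uniform in `u`. -/
theorem setAverage_mem_rateDomain {B : Set E} (hμB : μ B ≠ 0)
    (hint : IntegrableOn id B μ) : (⨍ x in B, x ∂μ) ∈ rateDomain μ := by
  set y := ⨍ x in B, x ∂μ with hy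
  refine ⟨μ B, hμB, fun u => ?_⟩
  have hint' : IntegrableOn (fun x => inner ℝ u (x - y)) B μ :=
    (hint.sub (integrable_const y)).const_inner u
  have hzero : ∫ x in B, inner ℝ u (x - y) ∂μ = 0 := by
    rw [integral_inner (f := fun x => x - y) (hint.sub (integrable_const y)), hy]
    have := integral_sub_average (μ.restrict B) (fun x : E => x)
    rw [this, inner_zero_right]
  have h1 : ∫ x in B, (1 + inner ℝ u (x - y)) ∂μ = μ.real B := by
    rw [integral_add (integrable_const _) hint', hzero]
    simp
  calc μ B = ENNReal.ofReal (∫ x in B, (1 + inner ℝ u (x - y)) ∂μ) := by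
        rw [h1, Measure.real, ENNReal.ofReal_toReal (measure_ne_top μ B)]
    _ ≤ ∫⁻ x in B, ENNReal.ofReal (1 + inner ℝ u (x - y)) ∂μ := 
        ofReal_integral_le_lintegral_ofReal ((integrable_const _).add hint')
    _ ≤ ∫⁻ x in B, ENNReal.ofReal (Real.exp (inner ℝ u (x - y))) ∂μ := by
        refine lintegral_mono fun x => ENNReal.ofReal_le_ofReal ?_
        have := Real.add_one_le_exp (inner ℝ u (x - y))
        linarith
    _ ≤ laplace μ y u := setLIntegral_le_lintegral _ _

theorem support_subset_closure_rateDomain : μ.support ⊆ closure (rateDomain μ) := by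
  intro x hx
  rw [Metric.mem_closure_iff]
  intro ε hε
  have hpos : μ (Metric.closedBall x (ε / 2)) ≠ 0 :=
    ((Measure.mem_support_iff_forall x).1 hx _ (Metric.closedBall_mem_nhds x (by positivity))).ne'
  have hint : IntegrableOn (id : E → E) (Metric.closedBall x (ε / 2)) μ :=
    continuous_id.continuousOn.integrableOn_compact (isCompact_closedBall x _)
  refine ⟨_, setAverage_mem_rateDomain μ hpos hint, ?_⟩
  have := (convex_closedBall x (ε / 2)).set_average_mem Metric.isClosed_closedBall hpos
    (measure_ne_top μ _) (ae_restrict_mem measurableSet_closedBall) hint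
  rw [dist_comm]
  exact (Metric.mem_closedBall.1 this).trans_lt (by linarith)

/-- If the law is carried by the open half-space `inner ℝ a (x - v) < 0`, then the Laplace
transform recentred at `v` tends to zero in the direction of `a`. -/
theorem notMem_rateDomain_of_ae_neg {a v : E} (h : ∀ᵐ x ∂μ, inner ℝ a (x - v) < 0) :
    v ∉ rateDomain μ := by
  rintro ⟨c, hc, hle⟩
  have hlim : Tendsto (fun n : ℕ => laplace μ v ((n : ℝ) • a)) atTop (𝓝 (∫⁻ _, 0 ∂μ)) := by
    refine tendsto_lintegral_of_dominated_convergence (fun _ => 1)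
      (fun n => measurable_ofReal_exp_inner _ v) (fun n => ?_) (by simp) ?_
    · filter_upwards [h] with x hx
      rw [ENNReal.ofReal_le_one, Real.exp_le_one_iff, real_inner_smul_left]
      exact mul_nonpos_of_nonneg_of_nonpos n.cast_nonneg hx.le
    · filter_upwards [h] with x hx
      rw [← ENNReal.ofReal_zero]
      refine ENNReal.tendsto_ofReal (Real.tendsto_exp_atBot.comp ?_)
      simp_rw [real_inner_smul_left]
      exact tendsto_natCast_atTop_atTop.atTop_mul_const_of_neg hx
  rw [lintegral_zero] at hlim
  exact hc (le_zero_iff.1 (ge_of_tendsto' hlim fun n => hle _))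

theorem rateDomain_subset_closure_convexHull_support :
    rateDomain μ ⊆ closure (convexHull ℝ μ.support) := by
  intro v hv
  by_contra hvc
  obtain ⟨f, s, hf, hs⟩ := geometric_hahn_banach_closed_point
    (convex_convexHull ℝ μ.support).closure isClosed_closure hvc
  refine notMem_rateDomain_of_ae_neg μ (a := (InnerProductSpace.toDual ℝ E).symm f) ?_ hv
  filter_upwards [ae_mem_convexHull_support μ] with x hx
  rw [InnerProductSpace.toDual_symm_apply, map_sub]
  linarith [hf x (subset_closure hx)]

theorem closure_rateDomain : closure (rateDomain μ) = closure (convexHull ℝ μ.support) :=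
  subset_antisymm
    (closure_minimal (rateDomain_subset_closure_convexHull_support μ) isClosed_closure)
    (closure_minimal (convexHull_min (support_subset_closure_rateDomain μ)
      (convex_rateDomain μ).closure) isClosed_closure)

theorem intrinsicInterior_rateDomain :
    intrinsicInterior ℝ (rateDomain μ) = intrinsicInterior ℝ (convexHull ℝ μ.support) := by
  rw [← intrinsicInterior_closure_eq_of_convex (convex_rateDomain μ), closure_rateDomain,
    intrinsicInterior_closure_eq_of_convex (convex_convexHull ℝ _)]

end Laplace

/-! ### Subgradients of K and the relative interior of D(I) -/

section Subgradient

variable {E : Type*} [NormedAddCommGroup E] [InnerProductSpace ℝ E] [MeasurableSpace E]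

/-- The logarithm of the Laplace transform as a real function (junk outside its domain). -/
def logLaplaceReal (μ : Measure E) (u : E) : ℝ := Real.log (laplace μ 0 u).toReal

/-- The effective domain of the Laplace transform. -/
def laplaceDomain (μ : Measure E) : Set E := {u | laplace μ 0 u ≠ ⊤}

/-- `v` is a subgradient of the logarithmic Laplace transform at `u`, i.e. `u` is a point of finite
value at which the Laplace transform recentred at `v` is minimal. -/
def IsSubgradientAt (μ : Measure E) (v u : E) : Prop :=
  u ∈ laplaceDomain μ ∧ ∀ u', laplace μ v u ≤ laplace μ v u'

variable [BorelSpace E] [FiniteDimensional ℝ E] (μ : Measure E) [IsProbabilityMeasure μ]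

variable {μ}

theorem laplace_eq_ofReal_exp {u : E} (hu : u ∈ laplaceDomain μ) (v : E) :
    laplace μ v u = ENNReal.ofReal (Real.exp (logLaplaceReal μ u - inner ℝ u v)) := by
  have hpos : 0 < (laplace μ 0 u).toReal := ENNReal.toReal_pos (laplace_ne_zero μ 0 u) hu
  rw [laplace_eq_mul μ 0 v u, sub_eq_add_neg (logLaplaceReal μ u), Real.exp_add,
    logLaplaceReal, Real.exp_log hpos,
    ENNReal.ofReal_mul hpos.le, ENNReal.ofReal_toReal hu, zero_sub, inner_neg_right]

theorem laplace_ne_top_iff {v u : E} : laplace μ v u ≠ ⊤ ↔ u ∈ laplaceDomain μ := by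
  rw [laplace_eq_mul μ 0 v u, laplaceDomain, Set.mem_ofPred_eq, not_iff_not,
    ENNReal.mul_eq_top]
  simp [Real.exp_pos]

theorem isSubgradientAt_iff {v u : E} : IsSubgradientAt μ v u ↔ u ∈ laplaceDomain μ ∧
    ∀ u' ∈ laplaceDomain μ, logLaplaceReal μ u + inner ℝ (u' - u) v ≤ logLaplaceReal μ u' := by
  refine and_congr_right fun hu => forall_congr' fun u' => ?_
  by_cases hu' : u' ∈ laplaceDomain μ
  · rw [laplace_eq_ofReal_exp hu, laplace_eq_ofReal_exp hu',
      ENNReal.ofReal_le_ofReal_iff (Real.exp_pos _).le, Real.exp_le_exp, inner_sub_left]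
    simp only [hu', true_imp_iff]
    constructor <;> intro h <;> linarith
  · have : laplace μ v u' = ⊤ := by
      by_contra h
      exact hu' (laplace_ne_top_iff.1 h)
    simp [this, hu']

theorem convex_laplaceDomain : Convex ℝ (laplaceDomain μ) := by
  intro x hx y hy s t hs ht hst
  have hle : laplace μ 0 (s • x + t • y) ≤ laplace μ 0 x + laplace μ 0 y := by
    rw [laplace, laplace, laplace, ← lintegral_add_left (measurable_ofReal_exp_inner _ _)]
    refine lintegral_mono fun w => ?_
    rw [← ENNReal.ofReal_add (Real.exp_pos _).le (Real.exp_pos _).le]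
    refine ENNReal.ofReal_le_ofReal ?_
    have hc := convexOn_exp.2 (Set.mem_univ (inner ℝ x (w - 0))) (Set.mem_univ (inner ℝ y (w - 0)))
      hs ht hst
    rw [inner_add_left, real_inner_smul_left, real_inner_smul_left]
    simp only [smul_eq_mul] at hc
    -- Only finiteness matters, so the weights are discarded.
    have h1 : s ≤ 1 := by linarith
    have h2 : t ≤ 1 := by linarith
    refine hc.trans (add_le_add ?_ ?_)
    · exact mul_le_of_le_one_left (Real.exp_pos _).le h1
    · exact mul_le_of_le_one_left (Real.exp_pos _).le h2
  exact ne_top_of_le_ne_top (ENNReal.add_ne_top.2 ⟨hx, hy⟩) hle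

theorem zero_mem_laplaceDomain : (0 : E) ∈ laplaceDomain μ := by
  simp [laplaceDomain, laplace_zero]

theorem IsSubgradientAt.eq_of_hasGradientAt {v m u : E} (h : IsSubgradientAt μ v u)
    (hu : u ∈ interior (laplaceDomain μ)) (hm : HasGradientAt (logLaplaceReal μ) m u) :
    v = m := by
  have hmin : IsLocalMin (fun w => logLaplaceReal μ w - inner ℝ v w) u := by
    filter_upwards [mem_interior_iff_mem_nhds.1 hu] with w hw
    have := (isSubgradientAt_iff.1 h).2 w hw
    rw [inner_sub_left, real_inner_comm, real_inner_comm v u] at this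
    linarith
  have hd := hmin.hasFDerivAt_eq_zero (hm.hasFDerivAt.sub ((innerSL ℝ v).hasFDerivAt))
  have h2 := DFunLike.congr_fun hd (m - v)
  have h3 : inner ℝ (m - v) (m - v) = (0 : ℝ) := by
    rw [inner_sub_left]
    simpa using h2
  exact (sub_eq_zero.1 (inner_self_eq_zero.1 h3)).symm

/-- Here `a` is in the normal cone of the domain at `u`; this is the source of non-uniqueness at
boundary points. -/
theorem IsSubgradientAt.add_of_inner_le {v a u : E} (h : IsSubgradientAt μ v u)
    (ha : ∀ q ∈ laplaceDomain μ, inner ℝ a q ≤ inner ℝ a u) : IsSubgradientAt μ (v + a) u := by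
  rw [isSubgradientAt_iff] at h ⊢
  refine ⟨h.1, fun q hq => ?_⟩
  have h1 := h.2 q hq
  have h2 := ha q hq
  rw [inner_add_right, real_inner_comm a, inner_sub_right]
  linarith

theorem ae_sub_mem_direction {z : E} (hz : z ∈ rateDomain μ) :
    ∀ᵐ x ∂μ, x - z ∈ (affineSpan ℝ (rateDomain μ)).direction := by
  filter_upwards [ae_mem_convexHull_support μ] with x hx
  refine sub_mem_direction_affineSpan hz ?_
  rw [← affineSpan_closure_eq, closure_rateDomain]
  exact subset_affineSpan ℝ _ (subset_closure hx)

/-- The point `z + r • y` stays in `rateDomain` for a small `r > 0`, and moving the centre there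
multiplies the transform by exp(-r u · y), which must not get too small. -/
theorem exists_inner_le_of_laplace_le_one {z : E}
    (hz : z ∈ intrinsicInterior ℝ (rateDomain μ)) {y : E}
    (hy : y ∈ (affineSpan ℝ (rateDomain μ)).direction) :
    ∃ C : ℝ, ∀ u, laplace μ z u ≤ 1 → inner ℝ u y ≤ C := by
  obtain ⟨r, hr, c, hc, hle⟩ := exists_pos_add_smul_mem_of_mem_intrinsicInterior hz hy
  refine ⟨- Real.log c.toReal / r, fun u hu => ?_⟩
  have h1 : c ≤ ENNReal.ofReal (Real.exp (-(r * inner ℝ u y))) := by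
    refine (hle u).trans ?_
    rw [laplace_eq_mul μ z]
    refine (mul_le_mul_left hu _).trans ?_
    rw [one_mul, sub_add_cancel_left, inner_neg_right, real_inner_smul_right]
  have hctop : c ≠ ⊤ := ne_top_of_le_ne_top ENNReal.ofReal_ne_top h1
  have hc0 : 0 < c.toReal := ENNReal.toReal_pos hc hctop
  have h2 : c.toReal ≤ Real.exp (-(r * inner ℝ u y)) := ENNReal.toReal_le_of_le_ofReal
    (Real.exp_pos _).le h1
  have h3 := (Real.log_le_iff_le_exp hc0).2 h2
  rw [le_div_iff₀ hr]
  linarith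

/-- As X - z lies a.s. in the direction space `W`, only the projection of `u` to `W` matters. There
the sublevel set at 1, the value at 0, is compact, and a lower semicontinuous function attains its
minimum on it. -/
theorem exists_isSubgradientAt {z : E} (hz : z ∈ intrinsicInterior ℝ (rateDomain μ)) :
    ∃ u, IsSubgradientAt μ z u := by
  have hzD := intrinsicInterior_subset hz
  set W := (affineSpan ℝ (rateDomain μ)).direction with hW
  have hproj : ∀ u, laplace μ z (W.orthogonalProjectionOnto u : E) = laplace μ z u := by
    intro u
    refine lintegral_congr_ae ?_
    filter_upwards [ae_sub_mem_direction hzD] with x hx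
    have := W.inner_orthogonalProjectionOnto_eq_of_mem_right ⟨x - z, hx⟩ u
    rw [Submodule.coe_inner] at this
    rw [this]
  set T : Set W := {w | laplace μ z w ≤ 1} with hT
  have hTclosed : IsClosed T :=
    ((lowerSemicontinuous_laplace μ z).isClosed_preimage 1).preimage continuous_subtype_val
  have hTne : T.Nonempty := ⟨0, by simp [hT, laplace_zero]⟩
  have hTbdd : Bornology.IsBounded T := by
    -- Bounds in the directions `y` and `-y` make the functionals of `T` pointwise bounded, hence
    -- bounded in norm.
    obtain ⟨C, hC⟩ := banach_steinhaus (g := fun w : T => innerSL ℝ (w : W)) fun y => by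
      obtain ⟨C₁, h₁⟩ := exists_inner_le_of_laplace_le_one hz y.2
      obtain ⟨C₂, h₂⟩ := exists_inner_le_of_laplace_le_one hz (W.neg_mem y.2)
      refine ⟨max C₁ C₂, fun w => ?_⟩
      have e₁ := h₁ _ w.2
      have e₂ := h₂ _ w.2
      rw [inner_neg_right] at e₂
      rw [innerSL_apply_apply, Submodule.coe_inner, Real.norm_eq_abs]
      exact abs_le'.2 ⟨le_max_of_le_left e₁, le_max_of_le_right e₂⟩
    refine isBounded_iff_forall_norm_le.2 ⟨C, fun w hw => ?_⟩
    simpa using hC ⟨w, hw⟩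
  obtain ⟨w, hwT, hw⟩ := LowerSemicontinuousOn.exists_isMinOn hTne
    (Metric.isCompact_of_isClosed_isBounded hTclosed hTbdd)
    (((lowerSemicontinuous_laplace μ z).comp continuous_subtype_val).lowerSemicontinuousOn T)
  refine ⟨w, laplace_ne_top_iff.1 (ne_top_of_le_ne_top ENNReal.one_ne_top hwT), fun u' => ?_⟩
  rw [← hproj u']
  by_cases h : W.orthogonalProjectionOnto u' ∈ T
  · exact isMinOn_iff.1 hw _ h
  · exact le_trans hwT (not_le.1 h).le

/-- Otherwise a nontrivial supporting normal `a` at `v` has a · (X - v) ≤ 0 a.s., strictly with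
positive probability, and passing from `u` to `u + a` strictly lowers the finite minimum. -/
theorem IsSubgradientAt.mem_intrinsicInterior {v u : E} (h : IsSubgradientAt μ v u) :
    v ∈ intrinsicInterior ℝ (rateDomain μ) := by
  have hfin : laplace μ v u ≠ ⊤ := laplace_ne_top_iff.2 h.1
  have hv : v ∈ rateDomain μ := ⟨_, laplace_ne_zero μ v u, h.2⟩
  by_contra hvn
  obtain ⟨a, ha, x, hx, hlt⟩ := exists_nontrivial_supporting_of_notMem_intrinsicInterior
    (convex_rateDomain μ) (subset_closure hv) hvn
  have hle : ∀ᵐ y ∂μ, inner ℝ a y ≤ inner ℝ a v := by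
    filter_upwards [ae_mem_convexHull_support μ] with y hy
    have hy' : y ∈ closure (rateDomain μ) := by
      rw [closure_rateDomain]
      exact subset_closure hy
    exact closure_minimal (t := {y | inner ℝ a y ≤ inner ℝ a v}) ha
      (isClosed_le (by fun_prop) continuous_const) hy'
  have hne : ∃ᵐ y ∂μ, inner ℝ a y ≠ inner ℝ a v := by
    intro hall
    have hcl : IsClosed {y : E | inner ℝ a y = inner ℝ a v} :=
      isClosed_eq (by fun_prop) continuous_const
    have hconv : Convex ℝ {y : E | inner ℝ a y = inner ℝ a v} :=
      convex_hyperplane (innerₛₗ ℝ a).isLinear _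
    have hsub : closure (convexHull ℝ μ.support) ⊆ {y : E | inner ℝ a y = inner ℝ a v} := by
      refine closure_minimal (convexHull_min (Measure.support_subset_of_isClosed hcl ?_) hconv) hcl
      filter_upwards [hall] with y hy using not_not.1 hy
    exact hlt.ne (hsub (rateDomain_subset_closure_convexHull_support μ hx))
  refine (h.2 (u + a)).not_gt ?_
  refine lintegral_strict_mono_of_ae_le_of_frequently_ae_lt
    (measurable_ofReal_exp_inner u v).aemeasurable
    (ne_top_of_le_ne_top hfin (lintegral_mono_ae ?_)) ?_ ?_
  · filter_upwards [hle] with y hy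
    refine ENNReal.ofReal_le_ofReal (Real.exp_le_exp.2 ?_)
    rw [inner_add_left, inner_sub_right a]
    linarith
  · filter_upwards [hle] with y hy
    refine ENNReal.ofReal_le_ofReal (Real.exp_le_exp.2 ?_)
    rw [inner_add_left, inner_sub_right a]
    linarith
  · refine (hne.and_eventually hle).mono fun y hy => ?_
    refine ((ENNReal.ofReal_lt_ofReal_iff (Real.exp_pos _)).2 (Real.exp_lt_exp.2 ?_)).ne
    have := lt_of_le_of_ne hy.2 hy.1
    rw [inner_add_left, inner_sub_right a]
    linarith

end Subgradient

/-! ### Differentiability of K inside its domain -/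

section Differentiability

variable {E : Type*} [NormedAddCommGroup E] [InnerProductSpace ℝ E] [MeasurableSpace E]
  [BorelSpace E] [FiniteDimensional ℝ E] {μ : Measure E} [IsProbabilityMeasure μ]

theorem mem_laplaceDomain_iff_integrable {u : E} :
    u ∈ laplaceDomain μ ↔ Integrable (fun x => Real.exp (inner ℝ u x)) μ := by
  have hm : AEStronglyMeasurable (fun x => Real.exp (inner ℝ u x)) μ :=
    (Continuous.aestronglyMeasurable (by fun_prop))
  rw [Integrable, and_iff_right hm, hasFiniteIntegral_iff_ofReal
    (Eventually.of_forall fun x => (Real.exp_pos _).le), laplaceDomain, Set.mem_ofPred_eq,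
    ← lt_top_iff_ne_top]
  simp [laplace]

theorem toReal_laplace_zero (u : E) :
    (laplace μ 0 u).toReal = ∫ x, Real.exp (inner ℝ u x) ∂μ := by
  rw [integral_eq_lintegral_of_nonneg_ae (Eventually.of_forall fun x => (Real.exp_pos _).le)
    (Continuous.aestronglyMeasurable (by fun_prop))]
  simp [laplace]

/-- Some coordinate of `x` is at least ‖x‖ / n in absolute value, so the integrand is dominated by
the sum of the exponentials at `u` and `u ± δ • b i`. Dividing by `n + 1` also covers dimension
zero. -/
theorem integrable_exp_inner_add_norm {u : E} (hu : u ∈ interior (laplaceDomain μ)) :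
    ∃ ε : ℝ, 0 < ε ∧ Integrable (fun x => Real.exp (inner ℝ u x + ε * ‖x‖)) μ := by
  obtain ⟨δ, hδ, hball⟩ := Metric.nhds_basis_closedBall.mem_iff.1 (mem_interior_iff_mem_nhds.1 hu)
  set n := Module.finrank ℝ E
  set b := stdOrthonormalBasis ℝ E
  have hε : 0 < δ / (n + 1) := by positivity
  have hint : ∀ w : E, ‖w‖ ≤ δ → Integrable (fun x => Real.exp (inner ℝ (u + w) x)) μ :=
    fun w hw => mem_laplaceDomain_iff_integrable.1 (hball (by simpa using hw))
  have hdom : Integrable (fun x => Real.exp (inner ℝ (u + 0) x)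
      + ∑ i, (Real.exp (inner ℝ (u + δ • b i) x)
      + Real.exp (inner ℝ (u + -(δ • b i)) x))) μ := by
    refine (hint 0 (by simpa using hδ.le)).add (integrable_finsetSum _ fun i _ => ?_)
    have hn : ‖δ • b i‖ ≤ δ := by simp [norm_smul, abs_of_pos hδ]
    exact (hint _ hn).add (hint _ (by rwa [norm_neg]))
  refine ⟨δ / (n + 1), hε, hdom.mono' (Continuous.aestronglyMeasurable (by fun_prop))
    (Eventually.of_forall fun x => ?_)⟩
  rw [Real.norm_eq_abs, abs_of_pos (Real.exp_pos _)]
  have hsum : ‖x‖ ≤ ∑ i, |inner ℝ (b i) x| := by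
    conv_lhs => rw [← b.sum_repr' x]
    refine (norm_sum_le _ _).trans (Finset.sum_le_sum fun i _ => ?_)
    simp [norm_smul]
  have hterm : ∀ i, 0 ≤ Real.exp (inner ℝ (u + δ • b i) x)
      + Real.exp (inner ℝ (u + -(δ • b i)) x) := fun i => by positivity
  by_cases hne : (Finset.univ : Finset (Fin n)).Nonempty
  · obtain ⟨i, -, hi⟩ := Finset.exists_max_image Finset.univ (fun i => |inner ℝ (b i) x|) hne
    have h1 : ‖x‖ ≤ n * |inner ℝ (b i) x| := by
      refine hsum.trans ((Finset.sum_le_card_nsmul _ _ _ hi).trans ?_)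
      simp [n]
    have h2 : δ / (n + 1) * ‖x‖ ≤ δ * |inner ℝ (b i) x| := by
      rw [div_mul_eq_mul_div, div_le_iff₀ (by positivity), mul_assoc]
      refine mul_le_mul_of_nonneg_left (h1.trans ?_) hδ.le
      nlinarith [abs_nonneg (inner ℝ (b i) x)]
    have h3 : Real.exp (inner ℝ u x + δ / (n + 1) * ‖x‖) ≤ Real.exp (inner ℝ (u + δ • b i) x)
        + Real.exp (inner ℝ (u + -(δ • b i)) x) := by
      rw [inner_add_left, inner_add_left, inner_neg_left, real_inner_smul_left]
      rcases abs_cases (inner ℝ (b i) x : ℝ) with ⟨h, -⟩ | ⟨h, -⟩ <;> rw [h] at h2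
      · exact le_add_of_le_of_nonneg (Real.exp_le_exp.2 (by linarith)) (Real.exp_pos _).le
      · exact le_add_of_nonneg_of_le (Real.exp_pos _).le (Real.exp_le_exp.2 (by linarith))
    exact h3.trans ((Finset.single_le_sum (fun j _ => hterm j) (Finset.mem_univ i)).trans
      (le_add_of_nonneg_left (Real.exp_pos _).le))
  · rw [Finset.not_nonempty_iff_eq_empty.1 hne, Finset.sum_empty] at hsum
    have hx : ‖x‖ = 0 := le_antisymm hsum (norm_nonneg x)
    rw [hx, mul_zero, add_zero, add_zero]
    exact le_add_of_nonneg_right (Finset.sum_nonneg fun j _ => hterm j)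

theorem exp_inner_mul_norm_le {ε : ℝ} (hε : 0 < ε) {u w : E} (hw : ‖w - u‖ ≤ ε / 2) (x : E) :
    Real.exp (inner ℝ w x) * ‖x‖ ≤ 2 / ε * Real.exp (inner ℝ u x + ε * ‖x‖) := by
  have h1 : inner ℝ w x ≤ inner ℝ u x + ε / 2 * ‖x‖ := by
    have := (real_inner_le_norm (w - u) x).trans (mul_le_mul_of_nonneg_right hw (norm_nonneg x))
    rw [inner_sub_left] at this
    linarith
  have h2 : ‖x‖ ≤ 2 / ε * Real.exp (ε / 2 * ‖x‖) := by
    have := Real.add_one_le_exp (ε / 2 * ‖x‖)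
    calc ‖x‖ = 2 / ε * (ε / 2 * ‖x‖) := by field_simp
      _ ≤ _ := mul_le_mul_of_nonneg_left (by linarith) (by positivity)
  calc Real.exp (inner ℝ w x) * ‖x‖
      ≤ Real.exp (inner ℝ u x + ε / 2 * ‖x‖) * (2 / ε * Real.exp (ε / 2 * ‖x‖)) := by gcongr
    _ = 2 / ε * Real.exp (inner ℝ u x + ε * ‖x‖) := by
      rw [mul_left_comm, ← Real.exp_add]
      ring_nf

theorem integrable_exp_inner_smul {u : E} (hu : u ∈ interior (laplaceDomain μ)) :
    Integrable (fun x => Real.exp (inner ℝ u x) • x) μ := by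
  obtain ⟨ε, hε, hint⟩ := integrable_exp_inner_add_norm hu
  refine (hint.const_mul (2 / ε)).mono' (Continuous.aestronglyMeasurable (by fun_prop))
    (Eventually.of_forall fun x => ?_)
  rw [norm_smul, Real.norm_eq_abs, abs_of_pos (Real.exp_pos _)]
  exact exp_inner_mul_norm_le hε (by simpa using (half_pos hε).le) x

/-- The mean of the law tilted by `exp (inner ℝ u ·)`. -/
def tiltedMean (μ : Measure E) (u : E) : E :=
  (laplace μ 0 u).toReal⁻¹ • ∫ x, Real.exp (inner ℝ u x) • x ∂μ

/-- Differentiation under the integral, dominated near `u` by the preceding exponential moment. -/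
theorem hasGradientAt_logLaplaceReal {u : E} (hu : u ∈ interior (laplaceDomain μ)) :
    HasGradientAt (logLaplaceReal μ) (tiltedMean μ u) u := by
  obtain ⟨ε, hε, hint⟩ := integrable_exp_inner_add_norm hu
  have hD : HasFDerivAt (fun w => ∫ x, Real.exp (inner ℝ w x) ∂μ)
      (∫ x, Real.exp (inner ℝ u x) • InnerProductSpace.toDual ℝ E x ∂μ) u := by
    refine hasFDerivAt_integral_of_dominated_of_fderiv_le
      (F' := fun w x => Real.exp (inner ℝ w x) • InnerProductSpace.toDual ℝ E x)
      (bound := fun x => 2 / ε * Real.exp (inner ℝ u x + ε * ‖x‖))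
      (Metric.ball_mem_nhds u (half_pos hε))
      (Eventually.of_forall fun w => Continuous.aestronglyMeasurable (by fun_prop))
      (mem_laplaceDomain_iff_integrable.1 (interior_subset hu))
      (Continuous.aestronglyMeasurable (by fun_prop)) ?_ (hint.const_mul _) ?_
    · refine Eventually.of_forall fun x w hw => ?_
      rw [norm_smul, Real.norm_eq_abs, abs_of_pos (Real.exp_pos _), LinearIsometryEquiv.norm_map]
      exact exp_inner_mul_norm_le hε (mem_ball_iff_norm.1 hw).le x
    · refine Eventually.of_forall fun x w _ => ?_
      have h := ((InnerProductSpace.toDual ℝ E x).hasFDerivAt (x := w)).exp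
      simp only [InnerProductSpace.toDual_apply_apply] at h
      simpa only [real_inner_comm] using h
  have hcomm : ∫ x, Real.exp (inner ℝ u x) • InnerProductSpace.toDual ℝ E x ∂μ
      = InnerProductSpace.toDual ℝ E (∫ x, Real.exp (inner ℝ u x) • x ∂μ) := by
    have h := ContinuousLinearMap.integral_comp_comm (innerSL ℝ : E →L[ℝ] E →L[ℝ] ℝ)
      (integrable_exp_inner_smul hu)
    have he : ∀ x : E, InnerProductSpace.toDual ℝ E x = innerSL ℝ x := fun x => by
      ext y
      simp
    simp_rw [he, ← h, map_smul]
  rw [hcomm] at hD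
  have hpos : 0 < (laplace μ 0 u).toReal :=
    ENNReal.toReal_pos (laplace_ne_zero μ 0 u) (interior_subset hu)
  have hlog := hD.log (by rw [← toReal_laplace_zero]; exact hpos.ne')
  rw [hasGradientAt_iff_hasFDerivAt, tiltedMean, map_smul]
  simp only [← toReal_laplace_zero] at hlog
  exact hlog

/-- Again 1 + t ≤ e^t, now under the tilted law, whose mean annihilates the linear term. -/
theorem isSubgradientAt_tiltedMean {u : E} (hu : u ∈ interior (laplaceDomain μ)) :
    IsSubgradientAt μ (tiltedMean μ u) u := by
  set m := tiltedMean μ u with hm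
  have huD := interior_subset hu
  refine ⟨huD, fun u' => ?_⟩
  have hpos : 0 < (laplace μ 0 u).toReal := ENNReal.toReal_pos (laplace_ne_zero μ 0 u) huD
  have hexp : Integrable (fun x => Real.exp (inner ℝ u x)) μ :=
    mem_laplaceDomain_iff_integrable.1 huD
  have hI : Integrable (fun x => Real.exp (inner ℝ u x) • (x - m)) μ := by
    simp_rw [smul_sub]
    exact (integrable_exp_inner_smul hu).sub (hexp.smul_const m)
  have hzero : ∫ x, Real.exp (inner ℝ u x) • (x - m) ∂μ = 0 := by
    simp_rw [smul_sub]
    rw [integral_sub (integrable_exp_inner_smul hu) (hexp.smul_const m), integral_smul_const,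
      ← toReal_laplace_zero, hm, tiltedMean, smul_smul, mul_inv_cancel₀ hpos.ne', one_smul,
      sub_self]
  have hI' : Integrable (fun x => inner ℝ (u' - u) (Real.exp (inner ℝ u x) • (x - m))) μ :=
    hI.const_inner _
  have hle : ENNReal.ofReal (Real.exp (-inner ℝ u m)
        * ∫ x, (Real.exp (inner ℝ u x)
          + inner ℝ (u' - u) (Real.exp (inner ℝ u x) • (x - m))) ∂μ) ≤ laplace μ m u' := by
    rw [← integral_const_mul]
    refine (ofReal_integral_le_lintegral_ofReal ((hexp.add hI').const_mul _)).trans ?_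
    refine lintegral_mono fun x => ENNReal.ofReal_le_ofReal ?_
    have h1 := Real.add_one_le_exp (inner ℝ (u' - u) (x - m))
    have h2 : Real.exp (inner ℝ u' (x - m)) = Real.exp (-inner ℝ u m) *
        (Real.exp (inner ℝ u x) * Real.exp (inner ℝ (u' - u) (x - m))) := by
      rw [← Real.exp_add, ← Real.exp_add, inner_sub_left, inner_sub_right u]
      ring_nf
    simp only [Pi.add_apply]
    rw [h2, real_inner_smul_right]
    refine mul_le_mul_of_nonneg_left ?_ (Real.exp_pos _).le
    nlinarith [mul_le_mul_of_nonneg_left h1 (Real.exp_pos (inner ℝ u x)).le]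
  refine le_of_eq_of_le ?_ hle
  rw [integral_add hexp hI', integral_inner hI, hzero, inner_zero_right, add_zero,
    ← toReal_laplace_zero, laplace_eq_ofReal_exp huD, logLaplaceReal, Real.exp_sub,
    Real.exp_log hpos, Real.exp_neg, div_eq_inv_mul]

end Differentiability

/-! ### Steepness and boundary subgradients -/

section Steepness

variable {E : Type*} [NormedAddCommGroup E] [InnerProductSpace ℝ E] [MeasurableSpace E]
  [BorelSpace E] [FiniteDimensional ℝ E] {μ : Measure E} [IsProbabilityMeasure μ]

/-- Uniqueness of subgradients forces every point with a subgradient to be interior. -/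
theorem mem_interior_of_isSubgradientAt
    (huniq : ∀ u x y, IsSubgradientAt μ x u → IsSubgradientAt μ y u → x = y) {v u : E}
    (h : IsSubgradientAt μ v u) : u ∈ interior (laplaceDomain μ) := by
  by_contra hu
  obtain ⟨a, ha0, ha⟩ :=
    exists_ne_zero_inner_le_of_notMem_interior convex_laplaceDomain h.1 hu
  exact ha0 (left_eq_add.1 (huniq u _ _ h (h.add_of_inner_le ha)))

/-- The graph of ∂K is closed: the subgradient inequality passes to the limit by lower
semicontinuity. -/
theorem isSubgradientAt_of_tendsto {m u : ℕ → E} {v p : E}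
    (h : ∀ n, IsSubgradientAt μ (m n) (u n)) (hm : Tendsto m atTop (𝓝 v))
    (hu : Tendsto u atTop (𝓝 p)) : IsSubgradientAt μ v p := by
  have hle : ∀ q ∈ laplaceDomain μ, laplace μ v p ≤ laplace μ v q := by
    intro q hq
    have hterm : ∀ n, laplace μ v (u n) ≤
        ENNReal.ofReal (Real.exp
          (logLaplaceReal μ q - inner ℝ (q - u n) (m n) - inner ℝ (u n) v)) := by
      intro n
      have := (isSubgradientAt_iff.1 (h n)).2 q hq
      rw [laplace_eq_ofReal_exp (h n).1]
      exact ENNReal.ofReal_le_ofReal (Real.exp_le_exp.2 (by linarith))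
    have hlim : Tendsto (fun n => ENNReal.ofReal
        (Real.exp (logLaplaceReal μ q - inner ℝ (q - u n) (m n) - inner ℝ (u n) v))) atTop
        (𝓝 (laplace μ v q)) := by
      rw [laplace_eq_ofReal_exp hq]
      refine ENNReal.tendsto_ofReal ((Real.continuous_exp.tendsto _).comp ?_)
      have h1 : Tendsto
          (fun n => (logLaplaceReal μ q - inner ℝ (q - u n) (m n) - inner ℝ (u n) v))
          atTop (𝓝 (logLaplaceReal μ q - inner ℝ (q - p) v - inner ℝ p v)) :=
        (tendsto_const_nhds.sub ((tendsto_const_nhds.sub hu).inner hm)).sub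
          (hu.inner tendsto_const_nhds)
      convert h1 using 2
      rw [inner_sub_left]
      ring
    have hlsc : laplace μ v p ≤ liminf (fun n => laplace μ v (u n)) atTop :=
      (lowerSemicontinuous_iff_le_liminf.1 (lowerSemicontinuous_laplace μ v) p).trans
        (liminf_le_liminf_of_le hu)
    exact hlsc.trans ((liminf_le_liminf (Eventually.of_forall hterm)).trans hlim.liminf_eq.le)
  refine ⟨?_, fun q => ?_⟩
  -- Membership of `p` in the domain is not assumed; it follows by comparison with 0.
  · refine laplace_ne_top_iff.1 (ne_top_of_le_ne_top ?_ (hle 0 zero_mem_laplaceDomain))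
    exact laplace_ne_top_iff.2 zero_mem_laplaceDomain
  · by_cases hq : q ∈ laplaceDomain μ
    · exact hle q hq
    · rw [not_not.1 (mt laplace_ne_top_iff.1 hq)]
      exact le_top

/-- If every subgradient is unique, the tilted means blow up at the boundary of the domain. -/
theorem tendsto_norm_tiltedMean_atTop
    (huniq : ∀ u x y, IsSubgradientAt μ x u → IsSubgradientAt μ y u → x = y) {u : ℕ → E} {p : E}
    (hu : ∀ n, u n ∈ interior (laplaceDomain μ)) (hp : p ∉ interior (laplaceDomain μ))
    (hup : Tendsto u atTop (𝓝 p)) : Tendsto (fun n => ‖tiltedMean μ (u n)‖) atTop atTop := by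
  by_contra hnot
  rw [tendsto_atTop] at hnot
  push Not at hnot
  obtain ⟨R, hR⟩ := hnot
  obtain ⟨v, -, φ, hφ, hlim⟩ := tendsto_subseq_of_frequently_bounded
    (x := fun n => tiltedMean μ (u n)) (Metric.isBounded_closedBall (x := (0 : E)) (r := R))
    (hR.mono fun n hn => by simpa using hn.le)
  exact hp (mem_interior_of_isSubgradientAt huniq (isSubgradientAt_of_tendsto
    (fun n => isSubgradientAt_tiltedMean (hu (φ n))) hlim (hup.comp hφ.tendsto_atTop)))

/-- Along a segment from a point with a subgradient to an interior point of the domain, the tilted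
means stay bounded. -/
theorem exists_norm_tiltedMean_le {x u₀ w : E} (hx : IsSubgradientAt μ x u₀)
    (hw : w ∈ interior (laplaceDomain μ)) :
    ∃ R : ℝ, ∀ t : ℝ, 0 < t → t ≤ 1 → ‖tiltedMean μ (u₀ + t • (w - u₀))‖ ≤ R := by
  have hcont : ContinuousAt (logLaplaceReal μ) w :=
    (hasGradientAt_logLaplaceReal hw).hasFDerivAt.continuousAt
  obtain ⟨ρ, hρ, hball⟩ := Metric.nhds_basis_closedBall.mem_iff.1 ((hcont.eventually
    (gt_mem_nhds (lt_add_one (logLaplaceReal μ w)))).and (mem_interior_iff_mem_nhds.1 hw))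
  set M := logLaplaceReal μ w + 1
  have hx' := isSubgradientAt_iff.1 hx
  -- The bound comes from testing the gradient `m` at the point of the ball around `w` lying in
  -- direction `m`, where K < `M`, with K(u) bounded below by the subgradient `x`.
  refine ⟨(M - logLaplaceReal μ u₀ - inner ℝ (w - u₀) x) / ρ, fun t ht ht1 => ?_⟩
  set u := u₀ + t • (w - u₀) with hu
  have hui : u ∈ interior (laplaceDomain μ) :=
    convex_laplaceDomain.add_smul_sub_mem_interior hx.1 hw ⟨ht, ht1⟩
  have hm := isSubgradientAt_iff.1 (isSubgradientAt_tiltedMean hui)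
  set m := tiltedMean μ u
  have hu0 : u₀ - u = -(t • (w - u₀)) := by rw [hu]; abel
  have h1 := hx'.2 u hm.1
  have h2 := hm.2 u₀ hx.1
  -- Monotonicity of ∂K between `u₀` and `u`.
  have hmono : inner ℝ (w - u₀) x ≤ inner ℝ (w - u₀) m := by
    rw [← neg_sub u₀ u, hu0, neg_neg, real_inner_smul_left] at h1
    rw [hu0, inner_neg_left, real_inner_smul_left] at h2
    exact le_of_mul_le_mul_left (by linarith) ht
  rw [le_div_iff₀ hρ]
  -- If `m = 0`, the test point is `w` itself.
  have hq : w + (ρ / ‖m‖) • m ∈ Metric.closedBall w ρ := by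
    rw [mem_closedBall_iff_norm, add_sub_cancel_left, norm_smul, norm_div, norm_norm,
      Real.norm_of_nonneg hρ.le]
    rcases eq_or_ne ‖m‖ 0 with h0 | h0
    · simpa [h0] using hρ.le
    · rw [div_mul_cancel₀ _ h0]
  have h3 := hm.2 _ (hball hq).2
  have h4 := (hball hq).1
  have hinner : inner ℝ (w + (ρ / ‖m‖) • m - u) m
      = (1 - t) * inner ℝ (w - u₀) m + ‖m‖ * ρ := by
    have : w + (ρ / ‖m‖) • m - u = (1 - t) • (w - u₀) + (ρ / ‖m‖) • m := by
      rw [hu]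
      module
    rw [this, inner_add_left, real_inner_smul_left, real_inner_smul_left,
      real_inner_self_eq_norm_mul_norm]
    rcases eq_or_ne ‖m‖ 0 with h0 | h0
    · simp [h0]
    · field_simp
  have h5 := mul_le_mul_of_nonneg_left hmono (sub_nonneg.2 ht1)
  have h6 : inner ℝ (u - u₀) x = t * inner ℝ (w - u₀) x := by
    rw [hu, add_sub_cancel_left, real_inner_smul_left]
  rw [hinner] at h3
  rw [h6] at h1
  linarith

/-- If the tilted means blow up at the boundary, then points with subgradients are interior. -/
theorem mem_interior_of_tendsto_norm_tiltedMean {w : E} (hw : w ∈ interior (laplaceDomain μ))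
    (hsteep : ∀ (u : ℕ → E) (p : E), (∀ n, u n ∈ interior (laplaceDomain μ)) →
      p ∈ frontier (laplaceDomain μ) → Tendsto u atTop (𝓝 p) →
      Tendsto (fun n => ‖tiltedMean μ (u n)‖) atTop atTop)
    {x u₀ : E} (hx : IsSubgradientAt μ x u₀) : u₀ ∈ interior (laplaceDomain μ) := by
  by_contra hu₀
  obtain ⟨R, hR⟩ := exists_norm_tiltedMean_le hx hw
  have ht : ∀ n : ℕ, (1 / ((n : ℝ) + 1)) ≤ 1 := fun n => by
    rw [div_le_one (by positivity)]
    linarith [n.cast_nonneg (α := ℝ)]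
  have hlim : Tendsto (fun n : ℕ => u₀ + (1 / ((n : ℝ) + 1)) • (w - u₀)) atTop (𝓝 u₀) := by
    simpa using (tendsto_one_div_add_atTop_nhds_zero_nat (𝕜 := ℝ)).smul_const (w - u₀)
      |>.const_add u₀
  have hinf := hsteep _ u₀ (fun n => convex_laplaceDomain.add_smul_sub_mem_interior hx.1 hw
    ⟨by positivity, ht n⟩) ⟨subset_closure hx.1, hu₀⟩ hlim
  obtain ⟨n, hn⟩ := (hinf.eventually_gt_atTop R).exists
  exact hn.not_ge (hR _ (by positivity) (ht n))

theorem subgradient_unique_of_mem_interior {x y u : E} (hu : u ∈ interior (laplaceDomain μ))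
    (hx : IsSubgradientAt μ x u) (hy : IsSubgradientAt μ y u) : x = y :=
  (hx.eq_of_hasGradientAt hu (hasGradientAt_logLaplaceReal hu)).trans
    (hy.eq_of_hasGradientAt hu (hasGradientAt_logLaplaceReal hu)).symm

theorem convex_setOf_isSubgradientAt (u : E) : Convex ℝ {v | IsSubgradientAt μ v u} := by
  intro x hx y hy s t hs ht hst
  rw [Set.mem_ofPred_eq, isSubgradientAt_iff] at *
  refine ⟨hx.1, fun q hq => ?_⟩
  have h1 := mul_le_mul_of_nonneg_left (hx.2 q hq) hs
  have h2 := mul_le_mul_of_nonneg_left (hy.2 q hq) ht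
  rw [inner_add_right, real_inner_smul_right, real_inner_smul_right]
  obtain rfl : t = 1 - s := by linarith
  linarith

end Steepness

/-! ### Transfer to the rate function and strict convexity -/

section Rate

variable {Ω : Type*} [MeasurableSpace Ω] {P : Measure Ω} [IsProbabilityMeasure P] {d : ℕ}
  {X : Ω → EuclideanSpace ℝ (Fin d)}

theorem logLaplace_eq_log_laplace (hX : Measurable X) (u : EuclideanSpace ℝ (Fin d)) :
    logLaplace P X u = ENNReal.log (laplace (P.map X) 0 u) := by
  rw [logLaplace, laplace, lintegral_map (measurable_ofReal_exp_inner u 0) hX]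
  simp

theorem effDomain_logLaplace (hX : Measurable X) :
    effDomain (logLaplace P X) = laplaceDomain (P.map X) := by
  ext u
  simp [effDomain, laplaceDomain, logLaplace_eq_log_laplace hX, lt_top_iff_ne_top]

theorem toReal_logLaplace (hX : Measurable X) :
    (fun u => (logLaplace P X u).toReal) = logLaplaceReal (P.map X) := by
  have := Measure.isProbabilityMeasure_map (μ := P) hX.aemeasurable
  ext u
  rw [logLaplace_eq_log_laplace hX, logLaplaceReal]
  by_cases h : laplace (P.map X) 0 u = ⊤
  · simp [h]
  · rw [ENNReal.log_pos_real (laplace_ne_zero _ _ _) h, EReal.toReal_coe]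

theorem rate_eq_iSup (hX : Measurable X) (v : EuclideanSpace ℝ (Fin d)) :
    rate P X v = ⨆ u, -ENNReal.log (laplace (P.map X) v u) := by
  refine iSup_congr fun u => ?_
  rw [logLaplace_eq_log_laplace hX, laplace_eq_mul _ 0 v u, ENNReal.log_mul_add,
    ENNReal.log_ofReal_of_pos (Real.exp_pos _), Real.log_exp, zero_sub, inner_neg_right,
    EReal.neg_add (by simp) (by simp), EReal.coe_neg, sub_eq_add_neg, sub_eq_add_neg,
    neg_neg, add_comm]

theorem effDomain_rate (hX : Measurable X) : effDomain (rate P X) = rateDomain (P.map X) := by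
  ext v
  rw [effDomain, Set.mem_ofPred_eq, rate_eq_iSup hX]
  constructor
  · intro h
    -- The witness is exp(-I(v)), nonzero because I(v) < ∞.
    refine ⟨EReal.exp (-⨆ u, -ENNReal.log (laplace (P.map X) v u)), ?_, fun u => ?_⟩
    · rw [ne_eq, EReal.exp_eq_zero_iff, EReal.neg_eq_bot_iff]
      exact h.ne
    · rw [← ENNReal.exp_log (laplace (P.map X) v u), EReal.exp_le_exp_iff, EReal.neg_le]
      exact le_iSup (fun u => -ENNReal.log (laplace (P.map X) v u)) u
  · rintro ⟨c, hc, hle⟩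
    refine (iSup_le fun u => EReal.neg_le_neg_iff.2 (ENNReal.log_le_log (hle u))).trans_lt ?_
    rw [lt_top_iff_ne_top, ne_eq, EReal.neg_eq_top_iff, ENNReal.log_eq_bot_iff]
    exact hc

theorem IsSubgradientAt.rate_eq (hX : Measurable X) {v u : EuclideanSpace ℝ (Fin d)}
    (h : IsSubgradientAt (P.map X) v u) :
    rate P X v = ((inner ℝ u v - logLaplaceReal (P.map X) u : ℝ) : EReal) := by
  have := Measure.isProbabilityMeasure_map (μ := P) hX.aemeasurable
  have hval : -ENNReal.log (laplace (P.map X) v u)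
      = ((inner ℝ u v - logLaplaceReal (P.map X) u : ℝ) : EReal) := by
    rw [laplace_eq_ofReal_exp h.1, ENNReal.log_ofReal_of_pos (Real.exp_pos _), Real.log_exp,
      ← EReal.coe_neg, neg_sub]
  rw [rate_eq_iSup hX, ← hval]
  exact le_antisymm (iSup_le fun u' => EReal.neg_le_neg_iff.2 (ENNReal.log_le_log (h.2 u')))
    (le_iSup (fun u => -ENNReal.log (laplace (P.map X) v u)) u)

theorem le_rate (hX : Measurable X) {v u : EuclideanSpace ℝ (Fin d)}
    (hu : u ∈ laplaceDomain (P.map X)) :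
    ((inner ℝ u v - logLaplaceReal (P.map X) u : ℝ) : EReal) ≤ rate P X v := by
  have := Measure.isProbabilityMeasure_map (μ := P) hX.aemeasurable
  rw [rate_eq_iSup hX]
  refine le_trans (le_of_eq ?_) (le_iSup (fun u => -ENNReal.log (laplace (P.map X) v u)) u)
  rw [laplace_eq_ofReal_exp hu, ENNReal.log_ofReal_of_pos (Real.exp_pos _), Real.log_exp,
    ← EReal.coe_neg, neg_sub]

theorem isSubgradientAt_of_rate_le (hX : Measurable X) {v u : EuclideanSpace ℝ (Fin d)}
    (hu : u ∈ laplaceDomain (P.map X))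
    (h : rate P X v ≤ ((inner ℝ u v - logLaplaceReal (P.map X) u : ℝ) : EReal)) :
    IsSubgradientAt (P.map X) v u := by
  have := Measure.isProbabilityMeasure_map (μ := P) hX.aemeasurable
  refine isSubgradientAt_iff.2 ⟨hu, fun q hq => ?_⟩
  have := EReal.coe_le_coe_iff.1 ((le_rate hX (v := v) hq).trans h)
  rw [inner_sub_left]
  linarith

theorem rate_eq_top_of_supporting (hX : Measurable X) {L : Set (EuclideanSpace ℝ (Fin d))}
    (hL : IsSupportingHyperplane L (closure (convexSupport P X))) (hP : P {ω | X ω ∈ L} = 0)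
    {v : EuclideanSpace ℝ (Fin d)} (hv : v ∈ L) : rate P X v = ⊤ := by
  have := Measure.isProbabilityMeasure_map (μ := P) hX.aemeasurable
  suffices h : v ∉ rateDomain (P.map X) by
    rw [← effDomain_rate hX] at h
    exact not_lt_top_iff.1 h
  obtain ⟨a, b, -, rfl, -, hside⟩ := hL
  have hvb : inner ℝ a v = b := hv
  have hmeas : MeasurableSet {x : EuclideanSpace ℝ (Fin d) | inner ℝ a x = b} :=
    (isClosed_eq (by fun_prop) continuous_const).measurableSet
  have hne : ∀ᵐ x ∂(P.map X), inner ℝ a x ≠ b := by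
    rw [ae_iff]
    simp only [ne_eq, not_not]
    rwa [Measure.map_apply hX hmeas]
  rcases hside with h | h
  · refine notMem_rateDomain_of_ae_neg _ (a := a) ?_
    filter_upwards [hne, ae_mem_convexHull_support (P.map X)] with x hx hxs
    rw [inner_sub_right, hvb, sub_neg]
    exact lt_of_le_of_ne (h (subset_closure hxs)) hx
  · refine notMem_rateDomain_of_ae_neg _ (a := -a) ?_
    filter_upwards [hne, ae_mem_convexHull_support (P.map X)] with x hx hxs
    rw [inner_neg_left, inner_sub_right, hvb, neg_neg_iff_pos, sub_pos]
    exact lt_of_le_of_ne (h (subset_closure hxs)) hx.symm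

/-- On the segment between two subgradients at `u`, I(z) = u · z - K(u) is affine. -/
theorem subgradient_unique_of_isStrictlyConvexOn (hX : Measurable X)
    (h : IsStrictlyConvexOn (rate P X) (intrinsicInterior ℝ (effDomain (rate P X))))
    (u x y : EuclideanSpace ℝ (Fin d)) (hx : IsSubgradientAt (P.map X) x u)
    (hy : IsSubgradientAt (P.map X) y u) : x = y := by
  have := Measure.isProbabilityMeasure_map (μ := P) hX.aemeasurable
  by_contra hxy
  have hseg : ∀ z ∈ segment ℝ x y, IsSubgradientAt (P.map X) z u := fun z hz =>
    (convex_setOf_isSubgradientAt u).segment_subset hx hy hz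
  refine h x y hxy (fun z hz => ?_) ⟨(innerₛₗ ℝ u).toAffineMap
    - AffineMap.const ℝ _ (logLaplaceReal (P.map X) u), fun z hz => ?_⟩
  · rw [effDomain_rate hX]
    exact (hseg z hz).mem_intrinsicInterior
  · rw [(hseg z hz).rate_eq hX]
    simp

/-- If I is affine on a segment, take `u` with the midpoint in ∂K(u). Then I(z) ≥ u · z - K(u) is an
equality at the midpoint, hence at both endpoints, which become two subgradients at one interior
point. -/
theorem isStrictlyConvexOn_of_mem_interior (hX : Measurable X)
    (hint : ∀ x u, IsSubgradientAt (P.map X) x u → u ∈ interior (laplaceDomain (P.map X))) :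
    IsStrictlyConvexOn (rate P X) (intrinsicInterior ℝ (effDomain (rate P X))) := by
  have := Measure.isProbabilityMeasure_map (μ := P) hX.aemeasurable
  rintro x y hxy hsub ⟨g, hg⟩
  rw [effDomain_rate hX] at hsub
  have hz : midpoint ℝ x y ∈ segment ℝ x y := midpoint_mem_segment x y
  obtain ⟨u, hu⟩ := exists_isSubgradientAt (hsub hz)
  have hgx := hg x (left_mem_segment ℝ x y)
  have hgy := hg y (right_mem_segment ℝ x y)
  have ez := hg _ hz
  rw [hu.rate_eq hX, EReal.coe_eq_coe_iff, AffineMap.map_midpoint, midpoint_eq_smul_add,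
    midpoint_eq_smul_add, inner_smul_right, inner_add_right, smul_eq_mul] at ez
  have ex := le_rate hX (v := x) hu.1
  have ey := le_rate hX (v := y) hu.1
  rw [hgx, EReal.coe_le_coe_iff] at ex
  rw [hgy, EReal.coe_le_coe_iff] at ey
  simp only [invOf_eq_inv] at ez
  refine hxy (subgradient_unique_of_mem_interior (hint _ _ hu)
    (isSubgradientAt_of_rate_le hX hu.1 ?_) (isSubgradientAt_of_rate_le hX hu.1 ?_))
  · rw [hgx, EReal.coe_le_coe_iff]
    linarith
  · rw [hgy, EReal.coe_le_coe_iff]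
    linarith

theorem gradient_toReal_logLaplace (hX : Measurable X) {u : EuclideanSpace ℝ (Fin d)}
    (hu : u ∈ interior (laplaceDomain (P.map X))) :
    gradient (fun w => (logLaplace P X w).toReal) u = tiltedMean (P.map X) u := by
  have := Measure.isProbabilityMeasure_map (μ := P) hX.aemeasurable
  rw [toReal_logLaplace hX]
  exact (hasGradientAt_logLaplaceReal hu).gradient

theorem isSteep_logLaplace_iff (hX : Measurable X) : IsSteep (logLaplace P X) ↔
    ∀ (u : ℕ → EuclideanSpace ℝ (Fin d)) (p : EuclideanSpace ℝ (Fin d)),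
      (∀ n, u n ∈ interior (laplaceDomain (P.map X))) → p ∈ frontier (laplaceDomain (P.map X)) →
      Tendsto u atTop (𝓝 p) →
      Tendsto (fun n => ‖tiltedMean (P.map X) (u n)‖) atTop atTop := by
  unfold IsSteep
  rw [effDomain_logLaplace hX]
  refine forall₃_congr fun u p hu => ?_
  simp_rw [gradient_toReal_logLaplace hX (hu _)]

theorem isStrictlyConvexOn_rate_iff (hX : Measurable X) :
    IsStrictlyConvexOn (rate P X) (intrinsicInterior ℝ (effDomain (rate P X))) ↔
      (interior (effDomain (logLaplace P X))).Nonempty ∧ IsSteep (logLaplace P X) := by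
  have := Measure.isProbabilityMeasure_map (μ := P) hX.aemeasurable
  rw [isSteep_logLaplace_iff hX, effDomain_logLaplace hX]
  constructor
  · intro h
    have huniq := subgradient_unique_of_isStrictlyConvexOn hX h
    refine ⟨?_, fun u p hu hp hup => tendsto_norm_tiltedMean_atTop huniq hu hp.2 hup⟩
    have hne : (rateDomain (P.map X)).Nonempty := by
      refine closure_nonempty_iff.1 ?_
      rw [closure_rateDomain]
      exact ((Measure.nonempty_support (NeZero.ne _)).convexHull).closure
    -- Any relative interior point of D(I) is a subgradient somewhere, and uniqueness puts that
    -- place in int D(K).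
    obtain ⟨z, hz⟩ := Set.Nonempty.intrinsicInterior (convex_rateDomain (P.map X)) hne
    obtain ⟨u, hu⟩ := exists_isSubgradientAt hz
    exact ⟨u, mem_interior_of_isSubgradientAt huniq hu⟩
  · rintro ⟨⟨w, hw⟩, hsteep⟩
    exact isStrictlyConvexOn_of_mem_interior hX fun x u hx =>
      mem_interior_of_tendsto_norm_tiltedMean hw hsteep hx

end Rate

end RateFunction

end

theorem proposition1p1 {Ω : Type*} [MeasurableSpace Ω] (P : MeasureTheory.Measure Ω)
    [MeasureTheory.IsProbabilityMeasure P] (d : ℕ) (hd : 1 ≤ d)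
    (X : Ω → EuclideanSpace ℝ (Fin d)) (hX : Measurable X) :
    (intrinsicInterior ℝ (RateFunction.convexSupport P X)
        ⊆ RateFunction.effDomain (RateFunction.rate P X) ∧
      RateFunction.effDomain (RateFunction.rate P X)
        ⊆ closure (RateFunction.convexSupport P X) ∧
      intrinsicInterior ℝ (RateFunction.effDomain (RateFunction.rate P X))
        = intrinsicInterior ℝ (RateFunction.convexSupport P X) ∧
      ∀ L : Set (EuclideanSpace ℝ (Fin d)),
        RateFunction.IsSupportingHyperplane L (closure (RateFunction.convexSupport P X)) →
        P {ω | X ω ∈ L} = 0 → ∀ v ∈ L, RateFunction.rate P X v = ⊤) ∧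
    (RateFunction.IsStrictlyConvexOn (RateFunction.rate P X)
        (intrinsicInterior ℝ (RateFunction.effDomain (RateFunction.rate P X))) ↔
      (interior (RateFunction.effDomain (RateFunction.logLaplace P X))).Nonempty ∧
        RateFunction.IsSteep (RateFunction.logLaplace P X)) := by
  have := Measure.isProbabilityMeasure_map (μ := P) hX.aemeasurable
  have hrint : intrinsicInterior ℝ (RateFunction.effDomain (RateFunction.rate P X))
      = intrinsicInterior ℝ (RateFunction.convexSupport P X) := by
    rw [RateFunction.effDomain_rate hX, RateFunction.intrinsicInterior_rateDomain]
    rfl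
  refine ⟨⟨?_, ?_, hrint, fun L hL hP v hv => RateFunction.rate_eq_top_of_supporting hX hL hP hv⟩,
    RateFunction.isStrictlyConvexOn_rate_iff hX⟩
  · rw [← hrint]
    exact intrinsicInterior_subset
  · rw [RateFunction.effDomain_rate hX]
    exact RateFunction.rateDomain_subset_closure_convexHull_support _
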